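/- **Definitions.** Let $\Sigma=\{0,\dots,q-1\}$. A code is a multiset $\mathcal C$ of words of $\Sigma^n$, and its rate is $\log_q|\mathcal C|/n$, where $|\mathcal C|$ counts multiplicity. A multiset $D$ of words is $(\rho,\ell)$-clustered if there are $Z_1,\dots,Z_n\subseteq\Sigma$ with $|Z_i|\le\ell$ such that $|\{i: x_i\notin Z_i\}|\le\rho n$ for every $x\in D$. A code is $(\rho,\ell,L)$-list-recoverable if it has no $(\rho,\ell)$-clustered sub-multiset of size $L+1$. For $0\le\rho\le1-\ell/q$ put $$h^*_{q,\ell}(\rho)=\rho\log_q\frac{q-\ell}{\rho}+(1-\rho)\log_q\frac{\ell}{1-\rho},$$ where the first term is $0$ if $\rho=0$. For a matrix $\Pi$ in $\mathcal S_\Sigma^{k\times n}$ ($\mathcal S_\Sigma$ being the permutations of $\Sigma$) and $z\in\mathbb F_2^k$ let $y^0=(0,\dots,0)$, let $y^i=y^{i-1}$ if $z_i=0$ and $y^i=(\Pi_{i,1}(y^{i-1}_1),\dots,\Pi_{i,n}(y^{i-1}_n))$ if $z_i=1$, and let $\mathrm{Enc}_\Pi(z)=y^k$. The alphabet-permutation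 (AP) code $\mathcal C_\Pi$ is the multiset of all $\mathrm{Enc}_\Pi(z)$, $z\in\mathbb F_2^k$. A distribution on $\mathcal S_\Sigma$ is $\ell$-wise $\delta$-independent if for any distinct $x_1,\dots,x_\ell\in\Sigma$ the law of $(\pi(x_1),\dots,\pi(x_\ell))$ has total variation distance at most $\delta$ from the uniform law on $\ell$-tuples of distinct elements of $\Sigma$. **Theorem.** There are universal constants $c,A>0$ such that the following holds. Let $q,\ell,L,n\ge1$ be integers with $q\ge2$ and $\ell<\min\{q,L\}$, let $0\le\rho\le1-\frac{\ell}{q}$, $\eta\ge\frac{2\log_q(2n/\ln2)}{n}$ and $\delta>0$. Let $$R=1-h^*_{q,\ell}(\rho)-\frac{\log_q\binom q\ell+\frac1n}{L+1}-\eta$$ and assume that $k:=R\cdot n\log_2 q$ is a non-negative integer. Put $\beta=\max\{0,\ \ell\log_2 q+\log_2\frac1\delta\}$. Then there are an integer $0\le b\le A\beta$ and a family $(T_u)_{u\in\{0,1\}^b}$ of permutations of $\Sigma$ such that the law $D$ of $T_u$ for uniformly random $u$ is $\ell$-wise $\delta$-independent, and such that, when $\Pi\in\mathcal S_\Sigma^{k\times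 n}$ has independent entries with law $D$, the random code $\mathcal C_\Pi$ has the following properties: it can be sampled from at most $A\,nk\,\beta$ independent unbiased random bits; it always has rate $R$; and $$\Pr\big[\mathcal C_\Pi\text{ is }(\rho,\ell,L)\text{-list-recoverable}\big]\ \ge\ 1-\sqrt2\,k\,q^{-\eta n/2}-c\,\delta\,n\,k\,q^{4\ell}.$$ -/

import Mathlib

open scoped ENNReal

noncomputable section

namespace APCode

/-! ### Codes and list-recoverability -/

/-- Words of length `n` over the alphabet `{0, …, q - 1}`. -/
abbrev Word (q n : ℕ) : Type := Fin n → Fin q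

/-- A code is a multiset of words (a codeword may have several messages). -/
abbrev Code (q n : ℕ) : Type := Multiset (Word q n)

/-- The rate `log_q |C| / n` of a code, its size being counted with multiplicity. -/
def rate {q n : ℕ} (C : Code q n) : ℝ :=
  Real.logb q (Multiset.card C) / n

/-- `(ρ, ℓ)`-clustered: some lists `Z₁, …, Zₙ` of size at most `ℓ` disagree with each word
in at most `ρ n` positions. -/
def IsClustered {q n : ℕ} (ρ : ℝ) (ℓ : ℕ) (D : Code q n) : Prop :=
  ∃ Z : Fin n → Finset (Fin q), (∀ i, (Z i).card ≤ ℓ) ∧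
    ∀ x ∈ D, ((Finset.univ.filter fun i => x i ∉ Z i).card : ℝ) ≤ ρ * n

/-- `(ρ, ℓ, L)`-list-recoverable: no clustered sub-multiset has `L + 1` elements. -/
def IsListRecoverable {q n : ℕ} (ρ : ℝ) (ℓ L : ℕ) (C : Code q n) : Prop :=
  ∀ D : Code q n, D ≤ C → Multiset.card D = L + 1 → ¬ IsClustered ρ ℓ D

/-- The function `h*_{q,ℓ}`. At `ρ = 0` the first summand is `0`, as usual. -/
def hStar (q ℓ : ℕ) (ρ : ℝ) : ℝ :=
  if ρ ≤ 1 - (ℓ : ℝ) / q then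
    ρ * Real.logb q (((q : ℝ) - ℓ) / ρ) + (1 - ρ) * Real.logb q ((ℓ : ℝ) / (1 - ρ))
  else 1

/-! ### Alphabet-permutation codes -/

/-- `k × n` matrices of permutations of the alphabet. -/
abbrev PermMatrix (q k n : ℕ) : Type := Fin k → Fin n → Equiv.Perm (Fin q)

/-- The encoding function: start from the zero word and, for `i = 1, …, k`, apply the `i`-th
row of permutations coordinatewise if the `i`-th message bit is `1`. -/
def enc {q n : ℕ} [NeZero q] : (k : ℕ) → PermMatrix q k n → (Fin k → ZMod 2) → Word q n
  | 0, _, _ => fun _ => 0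
  | k + 1, P, z =>
    let y := enc k (fun i => P i.castSucc) (fun i => z i.castSucc)
    if z (Fin.last k) = 0 then y else fun j => P (Fin.last k) j (y j)

/-- The alphabet-permutation code of a matrix, with multiplicities. -/
def apCode {q k n : ℕ} [NeZero q] (P : PermMatrix q k n) : Code q n :=
  (Finset.univ : Finset (Fin k → ZMod 2)).val.map (enc k P)

/-- The law of a `k × n` matrix with independent entries distributed according to `D`. -/
def iidMatrix {q : ℕ} (D : PMF (Equiv.Perm (Fin q))) (k n : ℕ) : PMF (PermMatrix q k n) :=
  PMF.ofFintype (fun P => ∏ i, ∏ j, D (P i j)) (by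
    have hD : ∑ p, D p = 1 := by rw [← tsum_fintype (L := .unconditional _)]; exact D.tsum_coe
    have h1 : ∑ r : Fin n → Equiv.Perm (Fin q), ∏ j, D (r j) = 1 := by
      rw [← Fintype.prod_sum (fun _ p => D p)]; simp [hD]
    rw [← Fintype.prod_sum (fun _ (r : Fin n → Equiv.Perm (Fin q)) => ∏ j, D (r j))]
    simp [h1])

/-- The `D`-random alphabet-permutation code. -/
def randomAPCode {q : ℕ} [NeZero q] (D : PMF (Equiv.Perm (Fin q))) (k n : ℕ) :
    PMF (Code q n) :=
  (iidMatrix D k n).map apCode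

/-! ### Near independence and randomness -/

/-- Total variation distance of distributions on a finite set. -/
def tvDist {Ω : Type*} [Fintype Ω] (P Q : PMF Ω) : ℝ :=
  (1 / 2) * ∑ ω, |(P ω).toReal - (Q ω).toReal|

/-- `m`-wise `δ`-independence of a distribution on permutations; tuples of `m` distinct
symbols are embeddings `Fin m ↪ Fin q`. -/
def IsNearIndependent {q : ℕ} (m : ℕ) (δ : ℝ) (D : PMF (Equiv.Perm (Fin q))) : Prop :=
  ∀ x : Fin m ↪ Fin q,
    haveI : Nonempty (Fin m ↪ Fin q) := ⟨x⟩
    tvDist (D.map fun p => x.trans p.toEmbedding) (PMF.uniformOfFintype (Fin m ↪ Fin q)) ≤ δ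

/-- The law of `g(u)` for `r` independent unbiased random bits `u`. -/
def fromBits {α : Type*} {r : ℕ} (g : (Fin r → Bool) → α) : PMF α :=
  (PMF.uniformOfFintype (Fin r → Bool)).map g

/-- The distribution `P` can be sampled exactly from `r` independent unbiased random bits. -/
def UsesRandomBits {α : Type*} (P : PMF α) (r : ℕ) : Prop :=
  ∃ g : (Fin r → Bool) → α, P = fromBits g

end APCode

end

open scoped ENNReal

noncomputable section

namespace APCode

/-! ### Laws of functions of uniform bits -/

/-! Call a list vector a choice of `n` lists of exactly `ℓ` symbols. For a matrix `P`, let `m(Z)`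
count the messages whose codeword misses `Z` in at most `ρ n` positions, and let the potential `φ`
be the average of `a ^ m(Z) - 1` over all `Z`. With `a ^ (L + 1) = q * (q choose ℓ) ^ n`, a single
violating `Z` already forces `φ ≥ 1`, so `φ < 1` certifies list-recoverability. Appending a row `r`
gives `m'(rZ) = m(rZ) + m(Z)`, hence `φ' = 2φ +` the correlation of the excess with its translate by
`r` (`potential_snoc`). Near `ℓ`-wise independence makes `rY` almost uniform, up to a factor `K = (1
+ δ (q choose ℓ)) ^ n` on point probabilities, so the expected correlation is at most `K φ²`
(`expected_correlation_le`). The potential thus essentially doubles with each row. Markov's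
inequality keeps it below slowly growing thresholds `s i ^ 2` with failure probability `K * s i` per
row (`prob_potential_le`). A Chernoff bound with exponent `hStar` controls the initial value
(`card_near_le`), and the definition of `R` leaves a margin `q ^ (-η n)` after `k` doublings. Short
seeds come from derandomizing the uniform permutation: a greedy choice of `2 ^ b` permutations keeps
all deviations from uniformity small in `ℓ²` (`exists_isNearIndependent`). -/

lemma map_uniform_apply {U α : Type*} [Fintype U] [Nonempty U] [DecidableEq α] (g : U → α)
    (y : α) : (PMF.uniformOfFintype U).map g y =
      ((Finset.univ.filter fun u => g u = y).card : ℝ≥0∞) * (Fintype.card U : ℝ≥0∞)⁻¹ := by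
  rw [PMF.map_apply, tsum_fintype]
  simp only [PMF.uniformOfFintype_apply, eq_comm (a := y)]
  rw [← Finset.sum_filter, Finset.sum_const, nsmul_eq_mul]

lemma map_uniform_toReal {U α : Type*} [Fintype U] [Nonempty U] [DecidableEq α] (g : U → α)
    (y : α) : ((PMF.uniformOfFintype U).map g y).toReal =
      ((Finset.univ.filter fun u => g u = y).card : ℝ) / Fintype.card U := by
  rw [map_uniform_apply, ENNReal.toReal_mul, ENNReal.toReal_inv]
  simp [div_eq_mul_inv]

lemma map_uniform_equiv {U V α : Type*} [Fintype U] [Nonempty U] [Fintype V] [Nonempty V]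
    (e : U ≃ V) (g : V → α) :
    (PMF.uniformOfFintype U).map (g ∘ e) = (PMF.uniformOfFintype V).map g := by
  classical
  ext y
  rw [map_uniform_apply, map_uniform_apply, Fintype.card_congr e]
  congr 2
  exact Finset.card_equiv e (by simp)

lemma iidMatrix_map_uniform {q : ℕ} {U : Type*} [Fintype U] [Nonempty U]
    (T : U → Equiv.Perm (Fin q)) (k n : ℕ) :
    iidMatrix ((PMF.uniformOfFintype U).map T) k n =
      (PMF.uniformOfFintype (Fin k → Fin n → U)).map fun V i j => T (V i j) := by
  classical
  ext P
  rw [map_uniform_apply]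
  have h : (Finset.univ.filter fun V : Fin k → Fin n → U => (fun i j => T (V i j)) = P) =
      Fintype.piFinset fun i => Fintype.piFinset fun j =>
        Finset.univ.filter fun u => T u = P i j := by
    ext V
    simp [funext_iff]
  rw [h, Fintype.card_piFinset]
  simp only [Fintype.card_piFinset, iidMatrix, PMF.ofFintype_apply, map_uniform_apply,
    Finset.prod_mul_distrib, Finset.prod_const, Finset.card_univ, Fintype.card_fin,
    Fintype.card_fun, Nat.cast_prod, Nat.cast_pow, ENNReal.inv_pow]

lemma usesRandomBits_randomAPCode {q b : ℕ} [NeZero q] (T : (Fin b → Bool) → Equiv.Perm (Fin q))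
    (k n : ℕ) : UsesRandomBits (randomAPCode (fromBits T) k n) (k * (n * b)) := by
  have hc : Fintype.card (Fin (k * (n * b)) → Bool) =
      Fintype.card (Fin k → Fin n → Fin b → Bool) := by
    simp only [Fintype.card_fun, Fintype.card_fin, Fintype.card_bool, ← pow_mul]
    congr 1
    ring
  let e := Fintype.equivOfCardEq hc
  refine ⟨(fun V => apCode fun i j => T (V i j)) ∘ e, ?_⟩
  have h : fromBits ((fun V => apCode fun i j => T (V i j)) ∘ e) = _ :=
    map_uniform_equiv e fun V => apCode fun i j => T (V i j)
  rw [h, randomAPCode, fromBits, iidMatrix_map_uniform, PMF.map_comp]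
  rfl

/-! ### The rate -/

lemma card_apCode {q k n : ℕ} [NeZero q] (P : PermMatrix q k n) :
    Multiset.card (apCode P) = 2 ^ k := by
  simp [apCode, ZMod.card]

lemma rate_of_mem_support {q k n : ℕ} [NeZero q] (hq : 2 ≤ q) (hn : 1 ≤ n) {R : ℝ}
    (hk : (k : ℝ) = R * Real.logb 2 q * n) (D : PMF (Equiv.Perm (Fin q))) {C : Code q n}
    (hC : C ∈ (randomAPCode D k n).support) : rate C = R := by
  rw [randomAPCode, PMF.mem_support_map_iff] at hC
  obtain ⟨P, -, rfl⟩ := hC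
  have hn' : (n : ℝ) ≠ 0 := by positivity
  have hq' : Real.log q ≠ 0 := (Real.log_pos (by exact_mod_cast hq)).ne'
  have h2 : Real.log 2 ≠ 0 := (Real.log_pos (by norm_num)).ne'
  rw [rate, card_apCode]
  push_cast
  rw [Real.logb_pow, hk, Real.logb, Real.logb]
  field_simp

/-! ### Small near-independent families of permutations -/

/-- Greedy choice: vectors of bounded norm averaging to zero have long partial sums of small
norm. -/
lemma exists_sum_sq_le {G ι : Type*} [Fintype G] [Nonempty G] [Fintype ι] (a : G → ι → ℝ)
    (V : ℝ) (h0 : ∀ i, ∑ p, a p i = 0) (hV : ∀ p, ∑ i, a p i ^ 2 ≤ V) (M : ℕ) :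
    ∃ f : Fin M → G, ∑ i, (∑ u, a (f u) i) ^ 2 ≤ M * V := by
  induction M with
  | zero => exact ⟨Fin.elim0, by simp⟩
  | succ M ih =>
    obtain ⟨f, hf⟩ := ih
    set v : ι → ℝ := fun i => ∑ u, a (f u) i with hv
    have hsum : ∑ p, ∑ i, v i * a p i = 0 := by
      rw [Finset.sum_comm]
      simp [← Finset.mul_sum, h0]
    -- The inner products with the partial sum `v` average to zero, so some `p` makes the cross term
    -- nonpositive; the squared norm then grows by at most `V`.
    obtain ⟨p, -, hp⟩ : ∃ p ∈ (Finset.univ : Finset G), ∑ i, v i * a p i ≤ 0 :=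
      Finset.exists_le_of_sum_le Finset.univ_nonempty (by simp [hsum])
    refine ⟨Fin.snoc f p, ?_⟩
    have hi : ∀ i, (∑ u, a ((Fin.snoc f p : Fin (M + 1) → G) u) i) ^ 2 =
        v i ^ 2 + 2 * (v i * a p i) + a p i ^ 2 := by
      intro i
      rw [Fin.sum_univ_castSucc]
      simp only [Fin.snoc_castSucc, Fin.snoc_last, hv]
      ring
    simp only [hi, Finset.sum_add_distrib, ← Finset.mul_sum]
    have := hV p
    push_cast
    linarith

/-- The symmetric group is multiply transitive, so left multiplication makes all fibres over target
tuples equinumerous, and these fibres partition the group. -/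
lemma card_perm_extending {q m : ℕ} (x y : Fin m ↪ Fin q) :
    (Fintype.card (Fin m ↪ Fin q) : ℝ) *
      ((Finset.univ.filter fun p : Equiv.Perm (Fin q) => x.trans p.toEmbedding = y).card : ℝ) =
      Fintype.card (Equiv.Perm (Fin q)) := by
  have key : ∀ y', (Finset.univ.filter fun p : Equiv.Perm (Fin q) =>
      x.trans p.toEmbedding = y').card =
      (Finset.univ.filter fun p : Equiv.Perm (Fin q) => x.trans p.toEmbedding = y).card := by
    intro y'
    obtain ⟨σ, hσ⟩ := (Equiv.Perm.isMultiplyPretransitive (Fin q) m).exists_smul_eq y' y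
    refine Finset.card_equiv (Equiv.mulLeft σ) fun p => ?_
    simp only [Finset.mem_filter, Finset.mem_univ, true_and, Equiv.coe_mulLeft]
    have hσ' : ∀ i, σ (y' i) = y i := fun i => by rw [← hσ]; rfl
    constructor
    · rintro rfl
      ext i
      simp [← hσ']
    · intro h
      ext i
      have := congrArg (fun f => f i) h
      simp only [Function.Embedding.trans_apply, Equiv.coe_toEmbedding, Equiv.Perm.mul_apply,
        ← hσ'] at this
      exact congrArg Fin.val (σ.injective this)
  have h := Finset.card_eq_sum_card_fiberwise (s := (Finset.univ : Finset (Equiv.Perm (Fin q))))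
    (t := (Finset.univ : Finset (Fin m ↪ Fin q))) (f := fun p => x.trans p.toEmbedding)
    (fun _ _ => Finset.mem_coe.2 (Finset.mem_univ _))
  simp only [key, Finset.sum_const, smul_eq_mul, Finset.card_univ] at h
  rw [h]
  push_cast
  ring

/-- The greedy lemma is applied to the centred indicators of `p` carrying tuple `x` to tuple `y`,
indexed by all pairs. Each `x` contributes at most `1` to the squared norm, whence `V = N`. For a
fixed `x`, Cauchy–Schwarz over the `N` targets gives total variation distance at most `N / (2 √(2 ^
b))`. -/
lemma exists_isNearIndependent {q m b : ℕ} {δ : ℝ} (hδ : 0 < δ)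
    (hb : ((q : ℝ) ^ m) ^ 2 ≤ 4 * δ ^ 2 * 2 ^ b) :
    ∃ T : (Fin b → Bool) → Equiv.Perm (Fin q), IsNearIndependent m δ (fromBits T) := by
  classical
  set N : ℝ := (Fintype.card (Fin m ↪ Fin q) : ℝ) with hN
  let a : Equiv.Perm (Fin q) → (Fin m ↪ Fin q) × (Fin m ↪ Fin q) → ℝ := fun p xy =>
    (if xy.1.trans p.toEmbedding = xy.2 then 1 else 0) - 1 / N
  have hNpos : ∀ x : (Fin m ↪ Fin q), 0 < N := fun x => by
    have : 0 < Fintype.card (Fin m ↪ Fin q) := Fintype.card_pos_iff.2 ⟨x⟩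
    rw [hN]; exact_mod_cast this
  have hNle : N ≤ (q : ℝ) ^ m := by
    have : Fintype.card (Fin m ↪ Fin q) ≤ q ^ m := by
      rw [Fintype.card_embedding_eq, Fintype.card_fin, Fintype.card_fin]
      exact Nat.descFactorial_le_pow q m
    rw [hN]; exact_mod_cast this
  have h0 : ∀ xy, ∑ p, a p xy = 0 := by
    rintro ⟨x, y⟩
    have h := card_perm_extending x y
    have := hNpos x
    simp only [a, Finset.sum_sub_distrib, Finset.sum_boole, Finset.sum_const, Finset.card_univ,
      nsmul_eq_mul]
    rw [← h]
    field_simp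
    simp [hN]
  have hV : ∀ p, ∑ xy, a p xy ^ 2 ≤ N := by
    intro p
    rw [Fintype.sum_prod_type]
    have hx : ∀ x : (Fin m ↪ Fin q), ∑ y, a p (x, y) ^ 2 ≤ 1 := by
      intro x
      have hp := hNpos x
      have h1 : ∀ y, a p (x, y) ^ 2 =
          (if x.trans p.toEmbedding = y then 1 else 0) * (1 - 2 / N) + 1 / N ^ 2 := by
        intro y
        simp only [a]
        split_ifs <;> ring
      simp only [h1, Finset.sum_add_distrib, ← Finset.sum_mul, Finset.sum_ite_eq,
        Finset.mem_univ, if_true, Finset.sum_const, Finset.card_univ, nsmul_eq_mul, ← hN]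
      have : N * (1 / N ^ 2) = 1 / N := by field_simp
      rw [this]
      have : 0 < 1 / N := by positivity
      have h2 : 2 / N = 2 * (1 / N) := by ring
      linarith
    calc ∑ x : (Fin m ↪ Fin q), ∑ y, a p (x, y) ^ 2 ≤ ∑ _x : (Fin m ↪ Fin q), (1 : ℝ) := Finset.sum_le_sum fun x _ => hx x
      _ = N := by simp [hN]
  obtain ⟨f, hf⟩ := exists_sum_sq_le a N h0 hV (2 ^ b)
  have hc : Fintype.card (Fin b → Bool) = Fintype.card (Fin (2 ^ b)) := by simp
  let e := Fintype.equivOfCardEq hc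
  refine ⟨f ∘ e, fun x => ?_⟩
  have : Nonempty (Fin m ↪ Fin q) := ⟨x⟩
  have hp := hNpos x
  set M : ℝ := 2 ^ b with hM
  have hMpos : 0 < M := by positivity
  set S : (Fin m ↪ Fin q) → ℝ := fun y => ∑ u, a (f u) (x, y) with hS
  have hSsq : ∑ y, S y ^ 2 ≤ M * N := by
    have h1 : ∑ y, S y ^ 2 ≤ ∑ x', ∑ y, (∑ u, a (f u) (x', y)) ^ 2 :=
      Finset.single_le_sum (f := fun x' => ∑ y, (∑ u, a (f u) (x', y)) ^ 2)
        (fun _ _ => Finset.sum_nonneg fun _ _ => sq_nonneg _) (Finset.mem_univ x)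
    rw [Fintype.sum_prod_type] at hf
    push_cast at hf
    exact h1.trans hf
  have hterm : ∀ y, ((fromBits (f ∘ e)).map (fun p => x.trans p.toEmbedding) y).toReal -
      (PMF.uniformOfFintype (Fin m ↪ Fin q) y).toReal = S y / M := by
    intro y
    rw [fromBits, map_uniform_equiv e, PMF.map_comp, map_uniform_toReal,
      PMF.uniformOfFintype_apply, ENNReal.toReal_inv]
    simp only [hS, a, Finset.sum_sub_distrib, Finset.sum_boole, Finset.sum_const, Finset.card_univ,
      nsmul_eq_mul, Fintype.card_fin, ENNReal.toReal_natCast, ← hN, Function.comp_apply]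
    push_cast
    rw [← hM]
    field_simp
  have hcs : (∑ y, |S y|) ^ 2 ≤ N * (M * N) := by
    have := sq_sum_le_card_mul_sum_sq (s := (Finset.univ : Finset (Fin m ↪ Fin q))) (f := fun y => |S y|)
    simp only [sq_abs, Finset.card_univ, ← hN] at this
    exact this.trans (by gcongr)
  rw [tvDist]
  simp only [hterm, abs_div, abs_of_pos hMpos, ← Finset.sum_div]
  have hN2 : N ^ 2 ≤ 4 * δ ^ 2 * M := (pow_le_pow_left₀ hp.le hNle 2).trans hb
  have hfin : ∑ y, |S y| ≤ 2 * δ * M := by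
    refine abs_le_of_sq_le_sq' ?_ (by positivity) |>.2
    calc (∑ y, |S y|) ^ 2 ≤ N ^ 2 * M := by linarith
      _ ≤ 4 * δ ^ 2 * M * M := by gcongr
      _ = (2 * δ * M) ^ 2 := by ring
  rw [one_div, inv_mul_le_iff₀ (by norm_num), div_le_iff₀ hMpos]
  exact hfin

lemma exists_small_isNearIndependent {q m : ℕ} (hq : 2 ≤ q) {δ : ℝ} (hδ : 0 < δ) :
    ∃ (b : ℕ) (T : (Fin b → Bool) → Equiv.Perm (Fin q)),
      (b : ℝ) ≤ 2 * max 0 (m * Real.logb 2 q + Real.logb 2 (1 / δ)) ∧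
      IsNearIndependent m δ (fromBits T) := by
  set β : ℝ := m * Real.logb 2 q + Real.logb 2 (1 / δ) with hβ
  have hq0 : (0 : ℝ) < q := by positivity
  have h2β : (2 : ℝ) ^ β = (q : ℝ) ^ m / δ := by
    rw [hβ, Real.rpow_add (by norm_num), Real.rpow_logb (by norm_num) (by norm_num) (by positivity),
      mul_comm (m : ℝ), Real.rpow_mul (by norm_num),
      Real.rpow_logb (by norm_num) (by norm_num) hq0, Real.rpow_natCast]
    ring
  -- The factor `4`, from the `1/2` in total variation, is the `-2` in the exponent. It also absorbs
  -- the rounding of the ceiling, so no additive constant appears in the bound on `b`.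
  have hb : ((q : ℝ) ^ m) ^ 2 ≤ 4 * δ ^ 2 * 2 ^ ⌈2 * β - 2⌉₊ := by
    have h1 : (2 : ℝ) ^ (2 * β - 2) ≤ 2 ^ ⌈2 * β - 2⌉₊ := by
      rw [← Real.rpow_natCast]
      exact Real.rpow_le_rpow_of_exponent_le (by norm_num) (Nat.le_ceil _)
    have h3 : (2 : ℝ) ^ (2 * β - 2) = ((q : ℝ) ^ m / δ) ^ 2 / 4 := by
      rw [Real.rpow_sub (by norm_num), mul_comm, Real.rpow_mul (by norm_num), h2β]
      norm_num
    rw [h3] at h1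
    calc ((q : ℝ) ^ m) ^ 2 = 4 * δ ^ 2 * (((q : ℝ) ^ m / δ) ^ 2 / 4) := by field_simp
      _ ≤ _ := by gcongr
  obtain ⟨T, hT⟩ := exists_isNearIndependent hδ hb
  refine ⟨_, T, ?_, hT⟩
  rcases le_or_gt (2 * β - 2) 0 with h | h
  · rw [Nat.ceil_eq_zero.2 h]
    simp
  · have := Nat.ceil_lt_add_one h.le
    have := le_max_right 0 β
    linarith

/-! ### Lists of exact size and the action of permutations -/

/-- Sets of `ℓ` symbols. -/
abbrev SymbolSet (q ℓ : ℕ) : Type := {s : Finset (Fin q) // s.card = ℓ}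

/-- Vectors of `n` lists, each of exactly `ℓ` symbols. -/
abbrev ListVec (q ℓ n : ℕ) : Type := Fin n → SymbolSet q ℓ

lemma card_symbolSet (q ℓ : ℕ) : Fintype.card (SymbolSet q ℓ) = q.choose ℓ := by
  simp

lemma card_listVec (q ℓ n : ℕ) : Fintype.card (ListVec q ℓ n) = q.choose ℓ ^ n := by
  simp

/-- The action of a permutation of the alphabet on sets of symbols. -/
def mapSet {q : ℕ} (ℓ : ℕ) (p : Equiv.Perm (Fin q)) : SymbolSet q ℓ ≃ SymbolSet q ℓ :=
  p.finsetCongr.subtypeEquiv fun s => by simp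

lemma apply_mem_mapSet {q ℓ : ℕ} (p : Equiv.Perm (Fin q)) (s : SymbolSet q ℓ) (x : Fin q) :
    p x ∈ (mapSet ℓ p s).1 ↔ x ∈ s.1 := by
  simp [mapSet]

/-- The coordinatewise action of a row of permutations. -/
def mapVec {q n : ℕ} (ℓ : ℕ) (r : Fin n → Equiv.Perm (Fin q)) : ListVec q ℓ n ≃ ListVec q ℓ n :=
  Equiv.piCongrRight fun j => mapSet ℓ (r j)

lemma mapVec_apply {q n ℓ : ℕ} (r : Fin n → Equiv.Perm (Fin q)) (Z : ListVec q ℓ n) (j : Fin n) :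
    mapVec ℓ r Z j = mapSet ℓ (r j) (Z j) := rfl

/-- The number of positions in which a word disagrees with the lists. -/
def misses {q n ℓ : ℕ} (x : Word q n) (Z : ListVec q ℓ n) : ℕ :=
  (Finset.univ.filter fun i => x i ∉ (Z i).1).card

lemma misses_mapVec {q n ℓ : ℕ} (r : Fin n → Equiv.Perm (Fin q)) (x : Word q n)
    (Z : ListVec q ℓ n) : misses (fun j => r j (x j)) (mapVec ℓ r Z) = misses x Z := by
  simp [misses, mapVec_apply, apply_mem_mapSet]

open Classical in
/-- The number of messages whose codeword is close to the lists. -/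
def nearCount {q k n ℓ : ℕ} [NeZero q] (ρ : ℝ) (P : PermMatrix q k n) (Z : ListVec q ℓ n) : ℕ :=
  (Finset.univ.filter fun z => (misses (enc k P z) Z : ℝ) ≤ ρ * n).card

lemma enc_snoc {q k n : ℕ} [NeZero q] (P : PermMatrix q k n) (r : Fin n → Equiv.Perm (Fin q))
    (z : Fin k → ZMod 2) (c : ZMod 2) :
    enc (k + 1) (Fin.snoc (α := fun _ => Fin n → Equiv.Perm (Fin q)) P r)
        (Fin.snoc (α := fun _ => ZMod 2) z c) =
      if c = 0 then enc k P z else fun j => r j (enc k P z j) := by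
  simp [enc]

/-- Messages ending in `0` keep their codeword; those ending in `1` have it moved by `r`, and moving
word and lists together preserves the misses. -/
lemma nearCount_snoc {q k n ℓ : ℕ} [NeZero q] (ρ : ℝ) (P : PermMatrix q k n)
    (r : Fin n → Equiv.Perm (Fin q)) (Z : ListVec q ℓ n) :
    nearCount ρ (Fin.snoc (α := fun _ => Fin n → Equiv.Perm (Fin q)) P r) (mapVec ℓ r Z) =
      nearCount ρ P (mapVec ℓ r Z) + nearCount ρ P Z := by
  classical
  simp only [nearCount, Finset.card_filter]
  rw [← (Fin.snocEquiv fun _ : Fin (k + 1) => ZMod 2).sum_comp, Fintype.sum_prod_type]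
  have h2 : (Finset.univ : Finset (ZMod 2)) = {0, 1} := rfl
  rw [h2, Finset.sum_pair (by decide)]
  congr 1
  · refine Finset.sum_congr rfl fun z _ => ?_
    rw [show (Fin.snocEquiv fun _ : Fin (k + 1) => ZMod 2) (0, z) =
      Fin.snoc (α := fun _ => ZMod 2) z 0 from rfl, enc_snoc, if_pos rfl]
  · refine Finset.sum_congr rfl fun z _ => ?_
    rw [show (Fin.snocEquiv fun _ : Fin (k + 1) => ZMod 2) (1, z) =
      Fin.snoc (α := fun _ => ZMod 2) z 1 from rfl, enc_snoc, if_neg (show ¬(1 : ZMod 2) = 0 by decide),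
      misses_mapVec]

/-! ### The potential of a code -/

/-- The excess of a list vector: `a` to the number of close messages, minus one. -/
def excess {q k n ℓ : ℕ} [NeZero q] (ρ a : ℝ) (P : PermMatrix q k n) (Z : ListVec q ℓ n) : ℝ :=
  a ^ nearCount ρ P Z - 1

lemma excess_nonneg {q k n ℓ : ℕ} [NeZero q] {ρ a : ℝ} (ha : 1 ≤ a) (P : PermMatrix q k n)
    (Z : ListVec q ℓ n) : 0 ≤ excess ρ a P Z :=
  sub_nonneg.2 (one_le_pow₀ ha)

/-- The average excess over all list vectors. -/
def potential {q k n : ℕ} [NeZero q] (ℓ : ℕ) (ρ a : ℝ) (P : PermMatrix q k n) : ℝ :=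
  (∑ Z : ListVec q ℓ n, excess ρ a P Z) / Fintype.card (ListVec q ℓ n)

/-- The correlation of the excess with its translate by a row. -/
def correlation {q k n : ℕ} [NeZero q] (ℓ : ℕ) (ρ a : ℝ) (P : PermMatrix q k n)
    (r : Fin n → Equiv.Perm (Fin q)) : ℝ :=
  (∑ Z : ListVec q ℓ n, excess ρ a P (mapVec ℓ r Z) * excess ρ a P Z) /
    Fintype.card (ListVec q ℓ n)

lemma correlation_nonneg {q k n ℓ : ℕ} [NeZero q] {ρ a : ℝ} (ha : 1 ≤ a) (P : PermMatrix q k n)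
    (r : Fin n → Equiv.Perm (Fin q)) : 0 ≤ correlation ℓ ρ a P r :=
  div_nonneg (Finset.sum_nonneg fun _ _ => mul_nonneg (excess_nonneg ha _ _)
    (excess_nonneg ha _ _)) (Nat.cast_nonneg _)

lemma potential_nonneg {q k n ℓ : ℕ} [NeZero q] {ρ a : ℝ} (ha : 1 ≤ a) (P : PermMatrix q k n) :
    0 ≤ potential ℓ ρ a P :=
  div_nonneg (Finset.sum_nonneg fun _ _ => excess_nonneg ha _ _) (Nat.cast_nonneg _)

/-- This is `xy - 1 = (x - 1) + (y - 1) + (x - 1)(y - 1)`, averaged after reindexing along the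
bijection `mapVec ℓ r`. -/
lemma potential_snoc {q k n ℓ : ℕ} [NeZero q] (ρ a : ℝ) (P : PermMatrix q k n)
    (r : Fin n → Equiv.Perm (Fin q)) :
    potential ℓ ρ a (Fin.snoc (α := fun _ => Fin n → Equiv.Perm (Fin q)) P r) =
      2 * potential ℓ ρ a P + correlation ℓ ρ a P r := by
  have h : ∑ Z : ListVec q ℓ n,
      excess ρ a (Fin.snoc (α := fun _ => Fin n → Equiv.Perm (Fin q)) P r) Z =
      ∑ Z : ListVec q ℓ n, (excess ρ a P (mapVec ℓ r Z) + excess ρ a P Z +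
        excess ρ a P (mapVec ℓ r Z) * excess ρ a P Z) := by
    rw [← (mapVec ℓ r).sum_comp]
    refine Finset.sum_congr rfl fun Z _ => ?_
    simp only [excess, nearCount_snoc, pow_add]
    ring
  rw [potential, h, Finset.sum_add_distrib, Finset.sum_add_distrib,
    (mapVec ℓ r).sum_comp fun Z => excess ρ a P Z, potential, correlation]
  ring

/-! ### Near independence of random rows -/

lemma sum_toReal_eq_one {α : Type*} [Fintype α] (D : PMF α) : ∑ x, (D x).toReal = 1 := by
  rw [← ENNReal.toReal_sum fun x _ => D.apply_ne_top x, ← tsum_fintype (L := .unconditional _),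
    D.tsum_coe, ENNReal.toReal_one]

lemma sum_filter_le_of_tvDist_le {Ω : Type*} [Fintype Ω] {P Q : PMF Ω} {δ : ℝ}
    (h : tvDist P Q ≤ δ) (E : Finset Ω) :
    ∑ ω ∈ E, (P ω).toReal ≤ ∑ ω ∈ E, (Q ω).toReal + δ := by
  classical
  have hP := Finset.sum_add_sum_compl E fun ω => (P ω).toReal
  have hQ := Finset.sum_add_sum_compl E fun ω => (Q ω).toReal
  have hA := Finset.sum_add_sum_compl E fun ω => |(P ω).toReal - (Q ω).toReal|
  rw [sum_toReal_eq_one] at hP hQ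
  have h1 : ∑ ω ∈ E, (P ω).toReal - ∑ ω ∈ E, (Q ω).toReal ≤
      ∑ ω ∈ E, |(P ω).toReal - (Q ω).toReal| := by
    rw [← Finset.sum_sub_distrib]
    exact Finset.sum_le_sum fun _ _ => le_abs_self _
  have h2 : ∑ ω ∈ Eᶜ, (Q ω).toReal - ∑ ω ∈ Eᶜ, (P ω).toReal ≤
      ∑ ω ∈ Eᶜ, |(P ω).toReal - (Q ω).toReal| := by
    rw [← Finset.sum_sub_distrib]
    exact Finset.sum_le_sum fun _ _ => by rw [abs_sub_comm]; exact le_abs_self _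
  rw [tvDist] at h
  linarith

lemma map_toReal_sum {α β : Type*} [Fintype α] [Fintype β] (D : PMF α) (g : α → β)
    (E : β → Prop) [DecidablePred E] :
    ∑ y with E y, (D.map g y).toReal = ∑ x with E (g x), (D x).toReal := by
  classical
  have h : ∀ y, (D.map g y).toReal = ∑ x, if g x = y then (D x).toReal else 0 := by
    intro y
    rw [PMF.map_apply, tsum_fintype, ENNReal.toReal_sum]
    · refine Finset.sum_congr rfl fun x _ => ?_
      simp only [eq_comm (a := y)]
      split_ifs <;> simp
    · intro x _
      split_ifs
      · exact D.apply_ne_top x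
      · simp
  simp only [h, Finset.sum_filter]
  rw [← Finset.sum_filter, Finset.sum_comm]
  refine Finset.sum_congr rfl fun x _ => ?_
  rw [Finset.sum_ite_eq]
  simp

lemma exists_map_univ_eq {q ℓ : ℕ} (s : SymbolSet q ℓ) :
    ∃ x : Fin ℓ ↪ Fin q, Finset.univ.map x = s.1 := by
  refine ⟨(s.1.orderEmbOfFin s.2).toEmbedding, ?_⟩
  rw [← Finset.coe_inj]
  simp

lemma card_embedding_image {q ℓ : ℕ} (s : SymbolSet q ℓ) :
    (Finset.univ.filter fun y : Fin ℓ ↪ Fin q => Finset.univ.map y = s.1).card *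
      q.choose ℓ = Fintype.card (Fin ℓ ↪ Fin q) := by
  classical
  have key : ∀ t : SymbolSet q ℓ,
      (Finset.univ.filter fun y : Fin ℓ ↪ Fin q => Finset.univ.map y = t.1).card =
      (Finset.univ.filter fun y : Fin ℓ ↪ Fin q => Finset.univ.map y = s.1).card := by
    intro t
    obtain ⟨x, hx⟩ := exists_map_univ_eq s
    obtain ⟨y, hy⟩ := exists_map_univ_eq t
    obtain ⟨σ, hσ⟩ := (Equiv.Perm.isMultiplyPretransitive (Fin q) ℓ).exists_smul_eq y x
    have hσ' : y.trans σ.toEmbedding = x := hσ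
    refine Finset.card_equiv (MulAction.toPerm σ) fun w => ?_
    have hw : MulAction.toPerm σ w = w.trans σ.toEmbedding := rfl
    simp only [Finset.mem_filter, Finset.mem_univ, true_and, hw, ← Finset.map_map, ← hx, ← hy,
      ← hσ', Finset.map_inj]
  have h := Finset.card_eq_sum_card_fiberwise (s := (Finset.univ : Finset (Fin ℓ ↪ Fin q)))
    (t := (Finset.univ : Finset (SymbolSet q ℓ))) (f := fun y => ⟨Finset.univ.map y, by simp⟩)
    (fun _ _ => Finset.mem_coe.2 (Finset.mem_univ _))
  simp only [Subtype.ext_iff, key, Finset.sum_const, smul_eq_mul, Finset.card_univ,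
    card_symbolSet] at h
  rw [h, mul_comm]

/-- The image of an `ℓ`-set depends only on the images of its `ℓ` elements, and the uniform law on
embeddings induces the uniform law on `ℓ`-sets; this is why lists of exact size are used. -/
lemma prob_mapSet_le {q ℓ : ℕ} {δ : ℝ} {D : PMF (Equiv.Perm (Fin q))}
    (hD : IsNearIndependent ℓ δ D) (s t : SymbolSet q ℓ) :
    ∑ p with mapSet ℓ p s = t, (D p).toReal ≤ 1 / (q.choose ℓ : ℝ) + δ := by
  classical
  obtain ⟨x, hx⟩ := exists_map_univ_eq s
  have : Nonempty (Fin ℓ ↪ Fin q) := ⟨x⟩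
  have h := sum_filter_le_of_tvDist_le (hD x)
    (Finset.univ.filter fun y : Fin ℓ ↪ Fin q => Finset.univ.map y = t.1)
  rw [map_toReal_sum] at h
  have he : ∀ p : Equiv.Perm (Fin q), mapSet ℓ p s = t ↔
      Finset.univ.map (x.trans p.toEmbedding) = t.1 := by
    intro p
    rw [← Finset.map_map, hx, Subtype.ext_iff]
    rfl
  simp only [he]
  refine h.trans (le_of_eq ?_)
  congr 1
  have hc := card_embedding_image t
  have hpos : 0 < Fintype.card (Fin ℓ ↪ Fin q) := Fintype.card_pos
  simp only [PMF.uniformOfFintype_apply, ENNReal.toReal_inv, ENNReal.toReal_natCast,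
    Finset.sum_const, nsmul_eq_mul]
  have hc' : ((Finset.univ.filter fun y : Fin ℓ ↪ Fin q => Finset.univ.map y = t.1).card : ℝ) *
      q.choose ℓ = Fintype.card (Fin ℓ ↪ Fin q) := by exact_mod_cast hc
  have hpos' : (0 : ℝ) < Fintype.card (Fin ℓ ↪ Fin q) := by exact_mod_cast hpos
  have hne : (q.choose ℓ : ℝ) ≠ 0 := by
    intro h0
    rw [h0, mul_zero] at hc'
    linarith
  rw [← hc'] at hpos' ⊢
  have := left_ne_zero_of_mul hpos'.ne'
  field_simp

/-- The probability of a row of independent permutations. -/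
def rowWeight {q n : ℕ} (D : PMF (Equiv.Perm (Fin q))) (r : Fin n → Equiv.Perm (Fin q)) : ℝ :=
  ∏ j, (D (r j)).toReal

lemma rowWeight_nonneg {q n : ℕ} (D : PMF (Equiv.Perm (Fin q)))
    (r : Fin n → Equiv.Perm (Fin q)) : 0 ≤ rowWeight D r :=
  Finset.prod_nonneg fun _ _ => ENNReal.toReal_nonneg

lemma sum_rowWeight {q n : ℕ} (D : PMF (Equiv.Perm (Fin q))) :
    ∑ r : Fin n → Equiv.Perm (Fin q), rowWeight D r = 1 := by
  simp only [rowWeight]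
  rw [← Fintype.prod_sum fun (_ : Fin n) p => (D p).toReal]
  simp [sum_toReal_eq_one]

lemma prob_mapVec_le {q n ℓ : ℕ} {δ : ℝ} {D : PMF (Equiv.Perm (Fin q))}
    (hD : IsNearIndependent ℓ δ D) (Y Z : ListVec q ℓ n) :
    ∑ r with mapVec ℓ r Y = Z, rowWeight D r ≤ (1 / (q.choose ℓ : ℝ) + δ) ^ n := by
  classical
  have h : (Finset.univ.filter fun r : Fin n → Equiv.Perm (Fin q) => mapVec ℓ r Y = Z) =
      Fintype.piFinset fun j => Finset.univ.filter fun p => mapSet ℓ p (Y j) = Z j := by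
    ext r
    simp [funext_iff, mapVec_apply]
  rw [h]
  simp only [rowWeight]
  rw [← Finset.prod_univ_sum
    (fun j => Finset.univ.filter fun p => mapSet ℓ p (Y j) = Z j) (fun _ p => (D p).toReal)]
  refine (Finset.prod_le_prod (fun j _ => Finset.sum_nonneg fun _ _ => ENNReal.toReal_nonneg)
    fun j _ => prob_mapSet_le hD (Y j) (Z j)).trans ?_
  simp

/-- The bound on point probabilities does not depend on the source `Y`, so the expected translated
excess is at most a constant times the average, and the double sum factors into `φ²`. -/
lemma expected_correlation_le {q k n ℓ : ℕ} [NeZero q] {ρ a δ : ℝ} (ha : 1 ≤ a) (hℓ : ℓ ≤ q)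
    {D : PMF (Equiv.Perm (Fin q))} (hD : IsNearIndependent ℓ δ D) (P : PermMatrix q k n) :
    ∑ r, rowWeight D r * correlation ℓ ρ a P r ≤
      (1 + δ * q.choose ℓ) ^ n * potential ℓ ρ a P ^ 2 := by
  classical
  set N : ℝ := (Fintype.card (ListVec q ℓ n) : ℝ) with hN
  have hC : (0 : ℝ) < q.choose ℓ := by exact_mod_cast Nat.choose_pos hℓ
  have hNC : N = (q.choose ℓ : ℝ) ^ n := by rw [hN, card_listVec]; push_cast; rfl
  have hNpos : 0 < N := by rw [hNC]; positivity
  have hY : ∀ Y : ListVec q ℓ n, ∑ r, rowWeight D r * excess ρ a P (mapVec ℓ r Y) ≤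
      (1 / (q.choose ℓ : ℝ) + δ) ^ n * ∑ Z : ListVec q ℓ n, excess ρ a P Z := by
    intro Y
    calc ∑ r, rowWeight D r * excess ρ a P (mapVec ℓ r Y)
        = ∑ r, ∑ Z, if mapVec ℓ r Y = Z then rowWeight D r * excess ρ a P Z else 0 := by simp
      _ = ∑ Z, (∑ r with mapVec ℓ r Y = Z, rowWeight D r) * excess ρ a P Z := by
          rw [Finset.sum_comm]
          simp only [Finset.sum_filter, Finset.sum_mul, ite_mul, zero_mul]
      _ ≤ ∑ Z, (1 / (q.choose ℓ : ℝ) + δ) ^ n * excess ρ a P Z :=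
          Finset.sum_le_sum fun Z _ =>
            mul_le_mul_of_nonneg_right (prob_mapVec_le hD Y Z) (excess_nonneg ha _ _)
      _ = _ := by rw [Finset.mul_sum]
  have hswap : ∑ r, rowWeight D r * correlation ℓ ρ a P r =
      (∑ Y : ListVec q ℓ n, (∑ r, rowWeight D r * excess ρ a P (mapVec ℓ r Y)) *
        excess ρ a P Y) / N := by
    simp only [correlation, ← mul_div_assoc, ← Finset.sum_div, Finset.mul_sum, Finset.sum_mul]
    rw [Finset.sum_comm]
    simp only [mul_assoc]
    rfl
  rw [hswap]
  calc _ ≤ (∑ Y : ListVec q ℓ n, ((1 / (q.choose ℓ : ℝ) + δ) ^ n *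
        ∑ Z : ListVec q ℓ n, excess ρ a P Z) * excess ρ a P Y) / N := by
        gcongr with Y
        · exact excess_nonneg ha _ _
        · exact hY Y
    _ = (1 + δ * q.choose ℓ) ^ n * potential ℓ ρ a P ^ 2 := by
        rw [← Finset.mul_sum, potential, ← hN]
        have : (1 / (q.choose ℓ : ℝ) + δ) ^ n = (1 + δ * q.choose ℓ) ^ n / N := by
          rw [hNC, ← div_pow]
          congr 1
          field_simp
        rw [this]
        field_simp

/-! ### The potential of the trivial code -/

lemma card_symbolSet_not_mem {q ℓ : ℕ} (i : Fin q) :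
    (Finset.univ.filter fun s : SymbolSet q ℓ => i ∉ s.1).card = (q - 1).choose ℓ := by
  have h : (Finset.univ.filter fun s : SymbolSet q ℓ => i ∉ s.1).map
      (Function.Embedding.subtype _) = Finset.powersetCard ℓ (Finset.univ.erase i) := by
    ext s
    simp [Finset.mem_powersetCard, Finset.subset_erase, and_comm]
  rw [← Finset.card_map, h, Finset.card_powersetCard, Finset.card_erase_of_mem (Finset.mem_univ i)]
  simp

lemma sum_symbolSet {q ℓ : ℕ} (hℓ : ℓ ≤ q) (i : Fin q) (x : ℝ) :
    ∑ s : SymbolSet q ℓ, (if i ∉ s.1 then x else 1) =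
      q.choose ℓ * ((ℓ + (q - ℓ) * x) / q) := by
  obtain ⟨m, rfl⟩ : ∃ m, q = m + 1 := ⟨q - 1, by have := i.2; omega⟩
  have h1 : ∀ s : SymbolSet (m + 1) ℓ, (if i ∉ s.1 then x else 1) =
      1 + (x - 1) * (if i ∉ s.1 then 1 else 0) := by
    intro s
    split_ifs <;> ring
  have h2 := Nat.choose_mul_succ_eq m ℓ
  have h3 : (m.choose ℓ : ℝ) * (m + 1) = (m + 1).choose ℓ * (m + 1 - ℓ) := by
    have : ((m.choose ℓ * (m + 1) : ℕ) : ℝ) = (((m + 1).choose ℓ * (m + 1 - ℓ) : ℕ) : ℝ) := by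
      rw [h2]
    rw [Nat.cast_mul, Nat.cast_mul, Nat.cast_sub hℓ] at this
    push_cast at this
    exact this
  simp only [h1, Finset.sum_add_distrib, ← Finset.mul_sum, Finset.sum_boole,
    card_symbolSet_not_mem, Finset.sum_const, Finset.card_univ, card_symbolSet, nsmul_eq_mul,
    mul_one, Nat.add_sub_cancel]
  have hm : (m : ℝ) + 1 ≠ 0 := by positivity
  push_cast
  rw [← mul_div_assoc, eq_div_iff hm]
  linear_combination (x - 1) * h3

lemma sum_pow_misses {q ℓ n : ℕ} (hℓ : ℓ ≤ q) (y : Word q n) (x : ℝ) :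
    ∑ Z : ListVec q ℓ n, x ^ misses y Z =
      Fintype.card (ListVec q ℓ n) * ((ℓ + (q - ℓ) * x) / q) ^ n := by
  have h : ∀ Z : ListVec q ℓ n, x ^ misses y Z = ∏ j, if y j ∉ (Z j).1 then x else 1 := by
    intro Z
    rw [Finset.prod_ite, Finset.prod_const, Finset.prod_const_one, mul_one, misses]
  simp only [h]
  rw [← Fintype.prod_sum fun j (s : SymbolSet q ℓ) => if y j ∉ s.1 then x else 1]
  simp only [sum_symbolSet hℓ, Finset.prod_const, Finset.card_univ, Fintype.card_fin, mul_pow,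
    card_listVec]
  push_cast
  rfl

/-- Chernoff bound: Markov's inequality for `x ^ misses`, whose average is the `n`-th power of a
one-coordinate average. -/
lemma card_near_le {q ℓ n : ℕ} {ρ : ℝ} (hℓ0 : 1 ≤ ℓ) (hℓ : ℓ < q) (h0 : 0 ≤ ρ)
    (h1 : ρ ≤ 1 - (ℓ : ℝ) / q) (y : Word q n) [DecidablePred fun Z : ListVec q ℓ n =>
      (misses y Z : ℝ) ≤ ρ * n] :
    ((Finset.univ.filter fun Z : ListVec q ℓ n => (misses y Z : ℝ) ≤ ρ * n).card : ℝ) ≤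
      Fintype.card (ListVec q ℓ n) * (q : ℝ) ^ ((hStar q ℓ ρ - 1) * n) := by
  have hl : (0 : ℝ) < ℓ := by exact_mod_cast hℓ0
  have hlq : (ℓ : ℝ) < q := by exact_mod_cast hℓ
  have hq : (0 : ℝ) < q := hl.trans hlq
  have hq1 : (q : ℝ) ≠ 1 := by
    have : (1 : ℝ) ≤ ℓ := by exact_mod_cast hℓ0
    linarith
  have hρ1 : 0 < 1 - ρ := by
    have : 0 < (ℓ : ℝ) / q := by positivity
    linarith
  have hql : (0 : ℝ) < q - ℓ := sub_pos.2 hlq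
  have h1' : ρ * q ≤ q - ℓ := by
    have := mul_le_mul_of_nonneg_right h1 hq.le
    rwa [sub_mul, one_mul, div_mul_cancel₀ _ hq.ne'] at this
  -- The optimal tilt; `x ≤ 1` amounts to `ρ ≤ 1 - ℓ / q`. At `ρ = 0` it degenerates to `x = 0`,
  -- where `x ^ misses` is the indicator of no misses and `x ^ ρ = 1`.
  set x : ℝ := ρ * ℓ / ((1 - ρ) * (q - ℓ)) with hx
  have hx0 : 0 ≤ x := by positivity
  have hx1 : x ≤ 1 := by
    rw [hx, div_le_one (by positivity)]
    nlinarith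
  have hbase : ((ℓ : ℝ) + (q - ℓ) * x) / q = ℓ / (1 - ρ) / q := by
    rw [hx]
    field_simp
    ring
  have hxρ : 0 < x ^ ρ := by
    rcases h0.eq_or_lt with h | h
    · rw [← h, Real.rpow_zero]; norm_num
    · have : 0 < x := by positivity
      positivity
  have hpow : x ^ ρ * (q : ℝ) ^ hStar q ℓ ρ = ℓ / (1 - ρ) := by
    have hl1 : (0 : ℝ) < ℓ / (1 - ρ) := by positivity
    have e1 : (q : ℝ) ^ ((1 - ρ) * Real.logb q (ℓ / (1 - ρ))) = (ℓ / (1 - ρ)) ^ (1 - ρ) := by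
      rw [mul_comm, Real.rpow_mul hq.le, Real.rpow_logb hq hq1 hl1]
    rw [hStar, if_pos h1, Real.rpow_add hq, e1]
    rcases h0.eq_or_lt with h | h
    · simp [← h]
    · have hlρ : 0 < ((q : ℝ) - ℓ) / ρ := by positivity
      rw [mul_comm ρ, Real.rpow_mul hq.le, Real.rpow_logb hq hq1 hlρ, ← mul_assoc,
        ← Real.mul_rpow hx0 hlρ.le]
      have : x * ((q - ℓ) / ρ) = ℓ / (1 - ρ) := by
        rw [hx]
        field_simp
      rw [this, ← Real.rpow_add hl1]
      simp
  have hmarkov : ∀ Z : ListVec q ℓ n, (misses y Z : ℝ) ≤ ρ * n →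
      (x ^ ρ) ^ n ≤ x ^ misses y Z := by
    intro Z hZ
    rcases h0.eq_or_lt with h | h
    · have : misses y Z = 0 := by
        rw [← h, zero_mul] at hZ
        exact_mod_cast le_antisymm hZ (Nat.cast_nonneg _)
      simp [this, ← h]
    · have hxp : 0 < x := by positivity
      rw [← Real.rpow_natCast, ← Real.rpow_natCast, ← Real.rpow_mul hx0]
      exact Real.rpow_le_rpow_of_exponent_ge hxp hx1 hZ
  have hsum : ((Finset.univ.filter fun Z : ListVec q ℓ n => (misses y Z : ℝ) ≤ ρ * n).card : ℝ) *
      (x ^ ρ) ^ n ≤ Fintype.card (ListVec q ℓ n) * (ℓ / (1 - ρ) / q) ^ n := by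
    rw [← hbase, ← sum_pow_misses hℓ.le y x, ← nsmul_eq_mul, ← Finset.sum_const]
    refine (Finset.sum_le_sum fun Z hZ => hmarkov Z (Finset.mem_filter.1 hZ).2).trans ?_
    exact Finset.sum_le_sum_of_subset_of_nonneg (Finset.subset_univ _)
      fun Z _ _ => pow_nonneg hx0 _
  refine le_of_mul_le_mul_right (hsum.trans (le_of_eq ?_)) (pow_pos hxρ n)
  rw [Real.rpow_mul hq.le, Real.rpow_natCast, mul_assoc, ← mul_pow, Real.rpow_sub hq,
    Real.rpow_one, ← hpow]
  ring

lemma potential_zero_le {q ℓ n : ℕ} [NeZero q] {ρ a : ℝ} (hℓ0 : 1 ≤ ℓ) (hℓ : ℓ < q)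
    (h0 : 0 ≤ ρ) (h1 : ρ ≤ 1 - (ℓ : ℝ) / q) (ha : 0 ≤ a) (P : PermMatrix q 0 n) :
    potential ℓ ρ a P ≤ a * (q : ℝ) ^ ((hStar q ℓ ρ - 1) * n) := by
  classical
  have hN : (0 : ℝ) < Fintype.card (ListVec q ℓ n) := by
    rw [card_listVec]
    exact_mod_cast pow_pos (Nat.choose_pos hℓ.le) n
  have h : ∀ Z : ListVec q ℓ n, excess ρ a P Z ≤
      a * if (misses (0 : Word q n) Z : ℝ) ≤ ρ * n then 1 else 0 := by
    intro Z
    have he : ∀ z, enc 0 P z = (0 : Word q n) := fun z => rfl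
    simp only [excess, nearCount, he]
    split_ifs with hc <;> simp [hc]
  rw [potential, div_le_iff₀ hN]
  refine (Finset.sum_le_sum fun Z _ => h Z).trans ?_
  rw [← Finset.mul_sum, Finset.sum_boole, mul_assoc, mul_comm _ (Fintype.card _ : ℝ)]
  exact mul_le_mul_of_nonneg_left (card_near_le hℓ0 hℓ h0 h1 0) ha

/-! ### A code of small potential is list-recoverable -/

lemma isListRecoverable_of_potential_lt_one {q k n ℓ L : ℕ} [NeZero q] {ρ a : ℝ} (hq : 2 ≤ q)
    (hℓ : ℓ ≤ q) (ha : 1 ≤ a) (haL : a ^ (L + 1) = (q.choose ℓ : ℝ) ^ n * q)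
    {P : PermMatrix q k n} (hP : potential ℓ ρ a P < 1) :
    IsListRecoverable ρ ℓ L (apCode P) := by
  classical
  rintro D hD hcard ⟨Z, hZ, hclose⟩
  -- Enlarging the lists to exactly `ℓ` symbols can only reduce the misses.
  have hex : ∀ i, ∃ t : Finset (Fin q), Z i ⊆ t ∧ t.card = ℓ := fun i =>
    Finset.exists_superset_card_eq (hZ i) (by simpa using hℓ)
  choose t hZt ht using hex
  let Y : ListVec q ℓ n := fun i => ⟨t i, ht i⟩
  have hle : L + 1 ≤ nearCount ρ P Y := by
    have h1 : D ≤ (apCode P).filter fun x => (misses x Y : ℝ) ≤ ρ * n := by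
      rw [Multiset.le_filter]
      refine ⟨hD, fun x hx => le_trans ?_ (hclose x hx)⟩
      refine Nat.cast_le.2 (Finset.card_le_card fun i hi => ?_)
      rw [Finset.mem_filter] at hi ⊢
      exact ⟨hi.1, fun hm => hi.2 (hZt i hm)⟩
    have h2 := Multiset.card_le_card h1
    rw [hcard, apCode, Multiset.filter_map, Multiset.card_map] at h2
    exact h2
  have hC : 1 ≤ (q.choose ℓ : ℝ) ^ n := one_le_pow₀ (by exact_mod_cast Nat.choose_pos hℓ)
  have hN : (Fintype.card (ListVec q ℓ n) : ℝ) = (q.choose ℓ : ℝ) ^ n := by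
    rw [card_listVec]
    push_cast
    rfl
  rw [potential, hN, div_lt_one (by linarith)] at hP
  have h1 : excess ρ a P Y ≤ ∑ Z : ListVec q ℓ n, excess ρ a P Z :=
    Finset.single_le_sum (fun Z _ => excess_nonneg ha P Z) (Finset.mem_univ Y)
  have h2 : a ^ (L + 1) ≤ a ^ nearCount ρ P Y := pow_le_pow_right₀ ha hle
  rw [haL] at h2
  rw [excess] at h1
  have hq' : (2 : ℝ) ≤ q := by exact_mod_cast hq
  -- With `C = (q choose ℓ) ^ n ≥ 1`, the single term `qC - 1` is at least `C`. The spare factor `q`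
  -- in `haL` is what the `1 / n` in the rate pays for.
  nlinarith

/-! ### Evolution of the potential -/

lemma sum_prod_rowWeight {q k n : ℕ} (D : PMF (Equiv.Perm (Fin q))) :
    ∑ P : PermMatrix q k n, ∏ i, rowWeight D (P i) = 1 := by
  rw [← Fintype.prod_sum fun (_ : Fin k) (r : Fin n → Equiv.Perm (Fin q)) => rowWeight D r]
  simp [sum_rowWeight]

open Classical in
-- From potential at most `s²`, exceeding `s'²` forces correlation above `s³`, which by Markov has
-- probability at most `K s⁴ / s³`.
lemma prob_potential_snoc_le {q k n ℓ : ℕ} [NeZero q] {ρ a K s s' : ℝ} (ha : 1 ≤ a)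
    {D : PMF (Equiv.Perm (Fin q))} (P : PermMatrix q k n)
    (hK : ∑ r, rowWeight D r * correlation ℓ ρ a P r ≤ K * potential ℓ ρ a P ^ 2) (hK0 : 0 ≤ K)
    (hs : 0 < s) (hs' : 2 * s ^ 2 + s ^ 3 ≤ s' ^ 2) :
    ∑ r, (if s' ^ 2 < potential ℓ ρ a (Fin.snoc (α := fun _ => Fin n → Equiv.Perm (Fin q)) P r)
        then rowWeight D r else 0) ≤
      (if s ^ 2 < potential ℓ ρ a P then 1 else 0) + K * s := by
  simp only [potential_snoc]
  have hs3 : 0 < s ^ 3 := by positivity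
  split_ifs with h
  · have : ∑ r, (if s' ^ 2 < 2 * potential ℓ ρ a P + correlation ℓ ρ a P r
        then rowWeight D r else 0) ≤ ∑ r : Fin n → Equiv.Perm (Fin q), rowWeight D r := by
      refine Finset.sum_le_sum fun r _ => ?_
      split_ifs
      · exact le_rfl
      · exact rowWeight_nonneg D r
    rw [sum_rowWeight] at this
    have : 0 ≤ K * s := by positivity
    linarith
  · rw [not_lt] at h
    have h1 : ∑ r, (if s' ^ 2 < 2 * potential ℓ ρ a P + correlation ℓ ρ a P r
        then rowWeight D r else 0) ≤ ∑ r, rowWeight D r * correlation ℓ ρ a P r / s ^ 3 := by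
      refine Finset.sum_le_sum fun r _ => ?_
      have hw := rowWeight_nonneg D r
      have hc := correlation_nonneg (ℓ := ℓ) (ρ := ρ) ha P r
      split_ifs with hr
      · rw [le_div_iff₀ hs3]
        exact mul_le_mul_of_nonneg_left (by linarith) hw
      · positivity
    rw [← Finset.sum_div] at h1
    have h2 : potential ℓ ρ a P ^ 2 ≤ (s ^ 2) ^ 2 :=
      pow_le_pow_left₀ (potential_nonneg ha P) h 2
    refine h1.trans ?_
    rw [zero_add, div_le_iff₀ hs3]
    calc _ ≤ K * potential ℓ ρ a P ^ 2 := hK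
      _ ≤ K * (s ^ 2) ^ 2 := by gcongr
      _ = K * s * s ^ 3 := by ring

open Classical in
lemma prob_potential_le {q n ℓ : ℕ} [NeZero q] {ρ a K B : ℝ} (ha : 1 ≤ a)
    {D : PMF (Equiv.Perm (Fin q))}
    (hK : ∀ (k : ℕ) (P : PermMatrix q k n),
      ∑ r, rowWeight D r * correlation ℓ ρ a P r ≤ K * potential ℓ ρ a P ^ 2) (hK0 : 0 ≤ K)
    (s : ℕ → ℝ) (h0 : ∀ P : PermMatrix q 0 n, potential ℓ ρ a P ≤ s 0 ^ 2) (k : ℕ)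
    (hs : ∀ i < k, 0 < s i) (hstep : ∀ i < k, 2 * s i ^ 2 + s i ^ 3 ≤ s (i + 1) ^ 2)
    (hB : ∀ i < k, s i ≤ B) :
    ∑ P : PermMatrix q k n, (if s k ^ 2 < potential ℓ ρ a P then ∏ i, rowWeight D (P i) else 0) ≤
      k * (K * B) := by
  induction k with
  | zero => simp [(h0 _).not_gt]
  | succ k ih =>
    have ih' := ih (fun i hi => hs i (by omega)) (fun i hi => hstep i (by omega))
      (fun i hi => hB i (by omega))
    rw [← (Fin.snocEquiv fun _ : Fin (k + 1) => Fin n → Equiv.Perm (Fin q)).sum_comp,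
      Fintype.sum_prod_type, Finset.sum_comm]
    have hP : ∀ P : PermMatrix q k n,
        ∑ r, (if s (k + 1) ^ 2 < potential ℓ ρ a
            ((Fin.snocEquiv fun _ : Fin (k + 1) => Fin n → Equiv.Perm (Fin q)) (r, P))
          then ∏ i, rowWeight D
            ((Fin.snocEquiv fun _ : Fin (k + 1) => Fin n → Equiv.Perm (Fin q)) (r, P) i)
          else 0) ≤
        (if s k ^ 2 < potential ℓ ρ a P then ∏ i, rowWeight D (P i) else 0) +
          (∏ i, rowWeight D (P i)) * (K * B) := by
      intro P
      have hW : 0 ≤ ∏ i, rowWeight D (P i) :=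
        Finset.prod_nonneg fun i _ => rowWeight_nonneg D _
      have h1 := mul_le_mul_of_nonneg_left (prob_potential_snoc_le ha P (hK k P) hK0
        (hs k (by omega)) (hstep k (by omega))) hW
      have h2 : K * s k ≤ K * B := mul_le_mul_of_nonneg_left (hB k (by omega)) hK0
      have h3 := mul_le_mul_of_nonneg_left h2 hW
      rw [Finset.mul_sum, mul_add, mul_ite, mul_one, mul_zero] at h1
      refine le_trans (le_of_eq (Finset.sum_congr rfl fun r _ => ?_))
        (h1.trans (add_le_add_right h3 _))
      rw [Fin.prod_univ_castSucc]
      simp [Fin.snocEquiv]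
    refine (Finset.sum_le_sum fun P _ => hP P).trans ?_
    rw [Finset.sum_add_distrib, ← Finset.sum_mul, sum_prod_rowWeight]
    push_cast
    linarith

lemma iidMatrix_toReal {q k n : ℕ} (D : PMF (Equiv.Perm (Fin q))) (P : PermMatrix q k n) :
    (iidMatrix D k n P).toReal = ∏ i, rowWeight D (P i) := by
  simp [iidMatrix, rowWeight, ENNReal.toReal_prod]

lemma prob_isListRecoverable_ge {q k n ℓ L : ℕ} [NeZero q] {ρ a K B δ : ℝ} (hq : 2 ≤ q)
    (hℓ : ℓ ≤ q) (ha : 1 ≤ a) (haL : a ^ (L + 1) = (q.choose ℓ : ℝ) ^ n * q) (hδ : 0 < δ)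
    {D : PMF (Equiv.Perm (Fin q))} (hD : IsNearIndependent ℓ δ D)
    (hKδ : K = (1 + δ * q.choose ℓ) ^ n)
    (s : ℕ → ℝ) (h0 : ∀ P : PermMatrix q 0 n, potential ℓ ρ a P ≤ s 0 ^ 2)
    (hs : ∀ i < k, 0 < s i) (hstep : ∀ i < k, 2 * s i ^ 2 + s i ^ 3 ≤ s (i + 1) ^ 2)
    (hB : ∀ i < k, s i ≤ B) (hk : s k ^ 2 < 1) :
    1 - k * (K * B) ≤ ((randomAPCode D k n).toOuterMeasure
      {C | IsListRecoverable ρ ℓ L C}).toReal := by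
  classical
  have hbad := prob_potential_le (ℓ := ℓ) (ρ := ρ) ha
    (fun k P => hKδ ▸ expected_correlation_le ha hℓ hD P) (by rw [hKδ]; positivity) s h0 k hs
    hstep hB
  rw [randomAPCode, PMF.toOuterMeasure_map_apply, PMF.toOuterMeasure_apply_fintype,
    ENNReal.toReal_sum]
  · have hsum := sum_prod_rowWeight (k := k) (n := n) D
    have hpt : ∀ P : PermMatrix q k n, ∏ i, rowWeight D (P i) ≤
        ((apCode ⁻¹' {C | IsListRecoverable ρ ℓ L C}).indicator (iidMatrix D k n) P).toReal +
        (if s k ^ 2 < potential ℓ ρ a P then ∏ i, rowWeight D (P i) else 0) := by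
      intro P
      have hW : 0 ≤ ∏ i, rowWeight D (P i) :=
        Finset.prod_nonneg fun i _ => rowWeight_nonneg D _
      split_ifs with h
      · exact le_add_of_nonneg_left ENNReal.toReal_nonneg
      · have hmem : P ∈ apCode ⁻¹' {C | IsListRecoverable ρ ℓ L C} :=
          isListRecoverable_of_potential_lt_one hq hℓ ha haL ((not_lt.1 h).trans_lt hk)
        rw [Set.indicator_of_mem hmem, iidMatrix_toReal, add_zero]
    have := Finset.sum_le_sum fun P (_ : P ∈ Finset.univ) => hpt P
    rw [Finset.sum_add_distrib, hsum] at this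
    linarith
  · intro P _
    rw [Set.indicator_apply]
    split_ifs
    · exact PMF.apply_ne_top _ _
    · simp

/-! ### Thresholds for the potential -/

/-- Reciprocals of the square roots of the thresholds, indexed by the number of rows still to be
added; they satisfy `v (j + 1) = √2 * v j + 1 / 4`. -/
def invThreshold (γ : ℝ) (j : ℕ) : ℝ := γ * √2 ^ j - (√2 + 1) / 4

lemma sqrt_two_bounds : 1.414 < √2 ∧ √2 < 1.415 :=
  ⟨Real.lt_sqrt_of_sq_lt (by norm_num), (Real.sqrt_lt' (by norm_num)).2 (by norm_num)⟩

lemma invThreshold_succ (γ : ℝ) (j : ℕ) :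
    invThreshold γ (j + 1) = √2 * invThreshold γ j + 1 / 4 := by
  have h : √2 ^ 2 = 2 := Real.sq_sqrt (by norm_num)
  simp only [invThreshold, pow_succ]
  linear_combination h / 4

lemma le_invThreshold {γ : ℝ} (hγ : 2.88 ≤ γ) (j : ℕ) : γ / √2 ≤ invThreshold γ j := by
  obtain ⟨h1, h2⟩ := sqrt_two_bounds
  have hs : (1 : ℝ) ≤ √2 ^ j := one_le_pow₀ (by linarith)
  have h : √2 ^ 2 = 2 := Real.sq_sqrt (by norm_num)
  have hd : γ / √2 = γ * √2 / 2 := by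
    field_simp
    linear_combination -h
  have : γ ≤ γ * √2 ^ j := le_mul_of_one_le_right (by linarith) hs
  rw [hd, invThreshold]
  nlinarith

lemma one_lt_invThreshold {γ : ℝ} (hγ : 2.88 ≤ γ) (j : ℕ) : 1 < invThreshold γ j := by
  obtain ⟨h1, h2⟩ := sqrt_two_bounds
  refine lt_of_lt_of_le ?_ (le_invThreshold hγ j)
  rw [lt_div_iff₀ (by linarith)]
  linarith

/-- After clearing denominators, the offset `1/4` makes the `u²` terms of `(2u + 1)(u - 1/4)²`
cancel, leaving `2u³ - 3u/8 + 1/16 ≤ 2u³`. -/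
lemma threshold_step {u v : ℝ} (hv : 1 < v) (hu : u = √2 * v + 1 / 4) :
    2 * (1 / u) ^ 2 + (1 / u) ^ 3 ≤ (1 / v) ^ 2 := by
  obtain ⟨h1, -⟩ := sqrt_two_bounds
  have h : √2 ^ 2 = 2 := Real.sq_sqrt (by norm_num)
  have hu1 : 1 < u := by nlinarith
  have hv2 : 2 * v ^ 2 = (u - 1 / 4) ^ 2 := by
    rw [hu]
    linear_combination -v ^ 2 * h
  have hl : 2 * (1 / u) ^ 2 + (1 / u) ^ 3 = (2 * u + 1) / u ^ 3 := by
    field_simp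
  rw [hl, one_div_pow, div_le_div_iff₀ (by positivity) (by positivity)]
  nlinarith

lemma initial_le_threshold {γ : ℝ} (hγ : 2.88 ≤ γ) (k : ℕ) :
    1 / (2 ^ k * γ ^ 2) ≤ (1 / invThreshold γ k) ^ 2 := by
  have h1 := one_lt_invThreshold hγ k
  have h2 : invThreshold γ k ≤ γ * √2 ^ k := by
    rw [invThreshold]
    have := sqrt_two_bounds.1
    linarith
  have h3 : (γ * √2 ^ k) ^ 2 = 2 ^ k * γ ^ 2 := by
    rw [mul_pow, ← pow_mul, mul_comm k, pow_mul, Real.sq_sqrt (by norm_num)]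
    ring
  rw [one_div_pow, ← h3]
  have : 0 < invThreshold γ k := by linarith
  gcongr

lemma one_add_pow_le {x : ℝ} (hx : 0 ≤ x) (n : ℕ) (h : n * x ≤ 1) :
    (1 + x) ^ n ≤ 1 + 2 * (n * x) := by
  have h0 : 0 ≤ n * x := by positivity
  calc (1 + x) ^ n ≤ (Real.exp x) ^ n := by
        gcongr
        rw [add_comm]
        exact Real.add_one_le_exp x
    _ = Real.exp (n * x) := (Real.exp_nat_mul x n).symm
    _ ≤ 1 + 2 * (n * x) := by
        have := (abs_le.1 (Real.abs_exp_sub_one_sub_id_le (x := n * x)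
          (by rwa [abs_of_nonneg h0]))).2
        nlinarith

lemma prob_isListRecoverable {q ℓ L n k : ℕ} [NeZero q] {ρ η δ R : ℝ} (hq : 2 ≤ q) (hn : 1 ≤ n)
    (hℓ0 : 1 ≤ ℓ) (hℓ : ℓ < q) (hρ0 : 0 ≤ ρ) (hρ1 : ρ ≤ 1 - (ℓ : ℝ) / q)
    (hη : 2 * Real.logb q (2 * n / Real.log 2) / n ≤ η) (hδ : 0 < δ)
    (hR : R = 1 - hStar q ℓ ρ - (Real.logb q (Nat.choose q ℓ) + 1 / n) / (L + 1) - η)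
    (hk : (k : ℝ) = R * Real.logb 2 q * n) {D : PMF (Equiv.Perm (Fin q))}
    (hD : IsNearIndependent ℓ δ D) :
    1 - √2 * k * (q : ℝ) ^ (-(η * n / 2)) - 2 * δ * n * k * (q : ℝ) ^ (4 * ℓ) ≤
      ((randomAPCode D k n).toOuterMeasure {C | IsListRecoverable ρ ℓ L C}).toReal := by
  have hq2 : (2 : ℝ) ≤ q := by exact_mod_cast hq
  have hq0 : (0 : ℝ) < q := by linarith
  have hq1 : (1 : ℝ) < q := by linarith
  have hn1 : (1 : ℝ) ≤ n := by exact_mod_cast hn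
  have hn0 : (0 : ℝ) < n := by linarith
  have hC1 : (1 : ℝ) ≤ q.choose ℓ := by exact_mod_cast Nat.choose_pos hℓ.le
  have hCq : (q.choose ℓ : ℝ) ≤ (q : ℝ) ^ (4 * ℓ) := by
    have h1 : (q.choose ℓ : ℝ) ≤ (q : ℝ) ^ ℓ := by exact_mod_cast Nat.choose_le_pow q ℓ
    exact h1.trans (pow_le_pow_right₀ hq1.le (by omega))
  set γ : ℝ := (q : ℝ) ^ (η * n / 2) with hγdef
  have hγ0 : 0 < γ := Real.rpow_pos_of_pos hq0 _
  -- The hypothesis on `η` gives `γ ≥ 2n / log 2 ≥ 2 / log 2 > 2.88`.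
  have hγ : 2.88 ≤ γ := by
    have hl0 : 0 < Real.log 2 := Real.log_pos (by norm_num)
    have hl := Real.log_two_lt_d9
    have h1 : Real.logb q (2 * n / Real.log 2) ≤ η * n / 2 := by
      rw [div_le_iff₀ hn0] at hη
      linarith
    rw [Real.logb_le_iff_le_rpow hq1 (by positivity)] at h1
    refine le_trans ?_ h1
    rw [le_div_iff₀ hl0]
    linarith
  have hγinv : (q : ℝ) ^ (-(η * n / 2)) = 1 / γ := by
    rw [Real.rpow_neg hq0.le, one_div]
  set σ : ℝ := (Real.logb q (Nat.choose q ℓ) + 1 / n) / (L + 1) with hσ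
  have hσ0 : 0 ≤ σ := by
    have : 0 ≤ Real.logb q (Nat.choose q ℓ) := Real.logb_nonneg hq1 hC1
    positivity
  set a : ℝ := (q : ℝ) ^ (σ * n) with hadef
  have ha : 1 ≤ a := Real.one_le_rpow hq1.le (by positivity)
  have haL : a ^ (L + 1) = (q.choose ℓ : ℝ) ^ n * q := by
    have he : σ * n * ((L + 1 : ℕ) : ℝ) = Real.logb q (Nat.choose q ℓ) * n + 1 := by
      rw [hσ]
      push_cast
      field_simp
    rw [hadef, ← Real.rpow_natCast, ← Real.rpow_mul hq0.le, he, Real.rpow_add hq0, Real.rpow_one,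
      Real.rpow_mul hq0.le, Real.rpow_logb hq0 hq1.ne' (by linarith), Real.rpow_natCast]
  have h2k : (2 : ℝ) ^ k = (q : ℝ) ^ (R * n) := by
    rw [← Real.rpow_natCast, hk, show R * Real.logb 2 q * n = Real.logb 2 q * (R * n) by ring,
      Real.rpow_mul (by norm_num), Real.rpow_logb (by norm_num) (by norm_num) hq0]
  have hinit : a * (q : ℝ) ^ ((hStar q ℓ ρ - 1) * n) = 1 / (2 ^ k * γ ^ 2) := by
    rw [h2k, hγdef, ← Real.rpow_natCast ((q : ℝ) ^ (η * n / 2)), ← Real.rpow_mul hq0.le,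
      ← Real.rpow_add hq0, ← Real.rpow_add hq0, one_div, ← Real.rpow_neg hq0.le]
    congr 1
    rw [hR]
    push_cast
    ring
  -- Time is reversed: after `i` rows the threshold is indexed by the `k - i` remaining ones, so it
  -- starts above the initial potential `1 / (2 ^ k * γ ^ 2)` and ends below `1`.
  have hmain := prob_isListRecoverable_ge (k := k) (n := n) (L := L) (ρ := ρ) (a := a)
    (B := √2 / γ) hq hℓ.le ha haL hδ hD rfl
    (fun i => 1 / invThreshold γ (k - i))
    (fun P => (potential_zero_le hℓ0 hℓ hρ0 hρ1 (by linarith) P).trans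
      (hinit.trans_le (initial_le_threshold hγ k)))
    (fun i _ => one_div_pos.2 (zero_lt_one.trans (one_lt_invThreshold hγ _)))
    (fun i hi => threshold_step (one_lt_invThreshold hγ _) (by
      rw [← invThreshold_succ]
      congr 1
      omega))
    (fun i _ => by
      have h := le_invThreshold hγ (k - i)
      have hs : (0 : ℝ) < √2 := by positivity
      rw [div_le_iff₀ (zero_lt_one.trans (one_lt_invThreshold hγ _))]
      calc (1 : ℝ) = √2 / γ * (γ / √2) := by field_simp
        _ ≤ _ := by gcongr)
    (by
      have h := one_lt_invThreshold hγ (k - k)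
      rw [one_div_pow, div_lt_one (by positivity)]
      exact one_lt_pow₀ h (by norm_num))
  rw [hγinv]
  -- If the `δ` term is at least `1` the claim is vacuous; otherwise, for `k ≥ 1`, `n δ (q choose ℓ)
  -- ≤ 1` and `K` can be linearised.
  by_cases htriv : 1 ≤ 2 * δ * n * k * (q : ℝ) ^ (4 * ℓ)
  · have : 0 ≤ √2 * k * (1 / γ) := by positivity
    exact le_trans (by linarith) ENNReal.toReal_nonneg
  refine le_trans ?_ hmain
  rcases Nat.eq_zero_or_pos k with rfl | hk0
  · simp
  rw [not_le] at htriv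
  have hk1 : (1 : ℝ) ≤ k := by exact_mod_cast hk0
  have hx : n * (δ * q.choose ℓ) ≤ δ * n * (q : ℝ) ^ (4 * ℓ) := by
    calc n * (δ * q.choose ℓ) = δ * n * q.choose ℓ := by ring
      _ ≤ _ := by gcongr
  have hx' : δ * n * (q : ℝ) ^ (4 * ℓ) ≤ 1 := by
    have : 0 ≤ δ * n * (q : ℝ) ^ (4 * ℓ) := by positivity
    nlinarith
  have hpow := one_add_pow_le (x := δ * q.choose ℓ) (by positivity) n (hx.trans hx')
  have hB : √2 / γ ≤ 1 := by
    rw [div_le_one hγ0]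
    linarith [sqrt_two_bounds.2]
  have hB0 : 0 ≤ √2 / γ := by positivity
  -- The error in `K` is multiplied by `√2 / γ ≤ 1`, so it separates into the additive `δ` term,
  -- with `c = 2`.
  have hKB : (1 + δ * q.choose ℓ) ^ n * (√2 / γ) ≤
      √2 / γ + 2 * (δ * n * (q : ℝ) ^ (4 * ℓ)) := by
    have : 0 ≤ n * (δ * q.choose ℓ) := by positivity
    nlinarith
  have hfin := mul_le_mul_of_nonneg_left hKB (Nat.cast_nonneg (α := ℝ) k)
  have : √2 * k * (1 / γ) = k * (√2 / γ) := by ring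
  rw [this]
  linarith

end APCode

end

theorem theorem1 :
    ∃ c A : ℝ, 0 < c ∧ 0 < A ∧
      ∀ (q ℓ L n k : ℕ) [NeZero q] (ρ η δ R : ℝ),
        2 ≤ q → 1 ≤ n → 1 ≤ ℓ → ℓ < min q L →
        0 ≤ ρ → ρ ≤ 1 - (ℓ : ℝ) / q →
        2 * Real.logb q (2 * n / Real.log 2) / n ≤ η →
        0 < δ →
        R = 1 - APCode.hStar q ℓ ρ
              - (Real.logb q (Nat.choose q ℓ) + 1 / n) / (L + 1) - η →
        (k : ℝ) = R * Real.logb 2 q * n →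
        -- a small near-independent family of permutations, indexed by `b`-bit strings
        ∃ (b r : ℕ) (T : (Fin b → Bool) → Equiv.Perm (Fin q)),
          (b : ℝ) ≤ A * max 0 (ℓ * Real.logb 2 q + Real.logb 2 (1 / δ)) ∧
          APCode.IsNearIndependent ℓ δ (APCode.fromBits T) ∧
          -- the number of random bits used by the ensemble
          APCode.UsesRandomBits (APCode.randomAPCode (APCode.fromBits T) k n) r ∧
          (r : ℝ) ≤ A * (n * k * max 0 (ℓ * Real.logb 2 q + Real.logb 2 (1 / δ))) ∧
          -- the rate
          (∀ C ∈ (APCode.randomAPCode (APCode.fromBits T) k n).support,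
            APCode.rate C = R) ∧
          -- list-recoverability with high probability
          1 - Real.sqrt 2 * k * (q : ℝ) ^ (-(η * n / 2)) - c * δ * n * k * (q : ℝ) ^ (4 * ℓ)
            ≤ ((APCode.randomAPCode (APCode.fromBits T) k n).toOuterMeasure
                {C | APCode.IsListRecoverable ρ ℓ L C}).toReal := by
  refine ⟨2, 2, by norm_num, by norm_num, ?_⟩
  intro q ℓ L n k _ ρ η δ R hq hn hℓ0 hℓ hρ0 hρ1 hη hδ hR hk
  obtain ⟨b, T, hb, hT⟩ := APCode.exists_small_isNearIndependent (m := ℓ) hq hδ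
  refine ⟨b, k * (n * b), T, hb, hT, APCode.usesRandomBits_randomAPCode T k n, ?_,
    fun C hC => APCode.rate_of_mem_support hq hn hk _ hC,
    APCode.prob_isListRecoverable hq hn hℓ0 (lt_min_iff.1 hℓ).1 hρ0 hρ1 hη hδ hR hk hT⟩
  have h : (n * k : ℝ) * b ≤
      n * k * (2 * max 0 (ℓ * Real.logb 2 q + Real.logb 2 (1 / δ))) := by gcongr
  push_cast
  linarith
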